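/- Let $J$ be James' space: the real Banach space of all real sequences $x=(x_j)_{j\ge 1}$ with $\lim_{j\to\infty}x_j=0$ and $$\|x\|=\sup\Big(\sum_{j=1}^{n}|x_{p_{j+1}}-x_{p_j}|^2\Big)^{1/2}<\infty ,$$ where the supremum is over all $n\in\mathbb N$ and all indices $1\le p_1<p_2<\dots<p_{n+1}$. Let $J^*$ be its dual space, and let $W(J^*)$ be the algebra, under composition and with the operator norm, of all weakly compact operators on $J^*$, that is, of all bounded linear operators $T:J^*\to J^*$ for which the image of the closed unit ball is relatively compact in the weak topology of $J^*$. **Corollary 3.5.** The Banach algebra $W(J^*)$ has a bounded left approximate identity: there is a bounded net $(V_\alpha)$ in $W(J^*)$ such that $\lim_\alpha\|U-V_\alpha U\|=0$ for every $U\in W(J^*)$. -/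

import Mathlib

open Filter Topology

noncomputable section

/-! ### James' space -/

/-- The sum `∑_{j=1}^n |x_{p_{j+1}} - x_{p_j}|²` along the indices `p 0 < p 1 < ⋯ < p n`. -/
def jamesSum (x : ℕ → ℝ) (n : ℕ) (p : ℕ → ℕ) : ℝ :=
  ∑ j ∈ Finset.range n, |x (p (j + 1)) - x (p j)| ^ 2

/-- All the sums whose supremum is the square of the square variation norm of `x`. Every finite
strictly increasing sequence of indices is an initial piece of a strictly increasing infinite
sequence, so nothing is lost by taking `p` to be defined on all of `ℕ`. -/
def jamesSums (x : ℕ → ℝ) : Set ℝ :=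
  {s | ∃ (n : ℕ) (p : ℕ → ℕ), StrictMono p ∧ s = jamesSum x n p}

/-- The square variation norm of a sequence (meaningful if `jamesSums x` is bounded above). -/
def jamesNorm (x : ℕ → ℝ) : ℝ := √(sSup (jamesSums x))

/-- Membership in James' space: null sequences of finite square variation. -/
def IsJamesSeq (x : ℕ → ℝ) : Prop :=
  Tendsto x atTop (𝓝 0) ∧ BddAbove (jamesSums x)

theorem jamesSum_nonneg (x : ℕ → ℝ) (n : ℕ) (p : ℕ → ℕ) : 0 ≤ jamesSum x n p :=
  Finset.sum_nonneg fun _ _ => by positivity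

theorem zero_mem_jamesSums (x : ℕ → ℝ) : 0 ∈ jamesSums x :=
  ⟨0, id, strictMono_id, by simp [jamesSum]⟩

theorem sqrt_jamesSum_le {x : ℕ → ℝ} (hx : BddAbove (jamesSums x)) (n : ℕ) {p : ℕ → ℕ}
    (hp : StrictMono p) : √(jamesSum x n p) ≤ jamesNorm x :=
  Real.sqrt_le_sqrt (le_csSup hx ⟨n, p, hp, rfl⟩)

theorem sqrt_jamesSum_add_le (x y : ℕ → ℝ) (n : ℕ) (p : ℕ → ℕ) :
    √(jamesSum (x + y) n p) ≤ √(jamesSum x n p) + √(jamesSum y n p) := by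
  refine Real.sqrt_le_iff.2 ⟨by positivity, ?_⟩
  have h := Real.sum_mul_le_sqrt_mul_sqrt (Finset.range n)
    (fun j => x (p (j + 1)) - x (p j)) (fun j => y (p (j + 1)) - y (p j))
  have e : jamesSum (x + y) n p = jamesSum x n p + jamesSum y n p +
      2 * ∑ j ∈ Finset.range n, (x (p (j + 1)) - x (p j)) * (y (p (j + 1)) - y (p j)) := by
    simp only [jamesSum, sq_abs, Pi.add_apply, Finset.mul_sum, ← Finset.sum_add_distrib]
    exact Finset.sum_congr rfl fun j _ => by ring
  have hx := Real.sq_sqrt (jamesSum_nonneg x n p)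
  have hy := Real.sq_sqrt (jamesSum_nonneg y n p)
  simp only [← sq_abs (_ - _)] at h
  change _ ≤ √(jamesSum x n p) * √(jamesSum y n p) at h
  rw [e]
  nlinarith

theorem jamesSum_smul (c : ℝ) (x : ℕ → ℝ) (n : ℕ) (p : ℕ → ℕ) :
    jamesSum (c • x) n p = c ^ 2 * jamesSum x n p := by
  simp only [jamesSum, sq_abs, Pi.smul_apply, smul_eq_mul, Finset.mul_sum]
  exact Finset.sum_congr rfl fun j _ => by ring

theorem jamesSum_add_le_sq {x y : ℕ → ℝ} (hx : BddAbove (jamesSums x))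
    (hy : BddAbove (jamesSums y)) (n : ℕ) {p : ℕ → ℕ} (hp : StrictMono p) :
    jamesSum (x + y) n p ≤ (jamesNorm x + jamesNorm y) ^ 2 :=
  (Real.sqrt_le_iff.1 ((sqrt_jamesSum_add_le x y n p).trans
    (add_le_add (sqrt_jamesSum_le hx n hp) (sqrt_jamesSum_le hy n hp)))).2

theorem jamesNorm_add_le {x y : ℕ → ℝ} (hx : BddAbove (jamesSums x))
    (hy : BddAbove (jamesSums y)) : jamesNorm (x + y) ≤ jamesNorm x + jamesNorm y := by
  refine Real.sqrt_le_iff.2 ⟨add_nonneg (Real.sqrt_nonneg _) (Real.sqrt_nonneg _),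
    csSup_le ⟨0, zero_mem_jamesSums _⟩ ?_⟩
  rintro _ ⟨n, p, hp, rfl⟩
  exact jamesSum_add_le_sq hx hy n hp

theorem bddAbove_jamesSums_smul (c : ℝ) {x : ℕ → ℝ} (hx : BddAbove (jamesSums x)) :
    BddAbove (jamesSums (c • x)) := by
  obtain ⟨C, hC⟩ := hx
  refine ⟨c ^ 2 * C, ?_⟩
  rintro _ ⟨n, p, hp, rfl⟩
  rw [jamesSum_smul]
  exact mul_le_mul_of_nonneg_left (hC ⟨n, p, hp, rfl⟩) (sq_nonneg c)

theorem jamesNorm_smul_le (c : ℝ) {x : ℕ → ℝ} (hx : BddAbove (jamesSums x)) :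
    jamesNorm (c • x) ≤ |c| * jamesNorm x := by
  refine Real.sqrt_le_iff.2 ⟨mul_nonneg (abs_nonneg _) (Real.sqrt_nonneg _),
    csSup_le ⟨0, zero_mem_jamesSums _⟩ ?_⟩
  rintro _ ⟨n, p, hp, rfl⟩
  rw [jamesSum_smul, mul_pow, sq_abs]
  exact mul_le_mul_of_nonneg_left
    (Real.sqrt_le_iff.1 (sqrt_jamesSum_le hx n hp)).2 (sq_nonneg c)

theorem jamesNorm_smul (c : ℝ) {x : ℕ → ℝ} (hx : BddAbove (jamesSums x)) :
    jamesNorm (c • x) = |c| * jamesNorm x := by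
  refine le_antisymm (jamesNorm_smul_le c hx) ?_
  rcases eq_or_ne c 0 with rfl | hc
  · rw [abs_zero, zero_mul]
    exact Real.sqrt_nonneg _
  · have h := jamesNorm_smul_le c⁻¹ (bddAbove_jamesSums_smul c hx)
    rw [smul_smul, inv_mul_cancel₀ hc, one_smul, abs_inv] at h
    rwa [← le_inv_mul_iff₀ (abs_pos.2 hc)]

theorem eq_zero_of_jamesNorm_eq_zero {x : ℕ → ℝ} (hx : IsJamesSeq x) (h : jamesNorm x = 0) :
    x = 0 := by
  have step : ∀ m k, m < k → x k = x m := by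
    intro m k hmk
    have hp : StrictMono fun j : ℕ => m + j * (k - m) := by
      intro a b hab
      have : a * (k - m) < b * (k - m) := Nat.mul_lt_mul_of_pos_right hab (by omega)
      simpa using this
    have h1 := sqrt_jamesSum_le hx.2 1 hp
    rw [h] at h1
    have h2 : |x k - x m| ^ 2 = 0 := by
      have h3 := (Real.sqrt_eq_zero (jamesSum_nonneg x 1 _)).1 (le_antisymm h1 (Real.sqrt_nonneg _))
      simpa [jamesSum, Nat.add_sub_cancel' hmk.le] using h3
    have h4 : x k - x m = 0 := by simpa using h2
    linarith
  funext m
  have hev : x =ᶠ[atTop] fun _ => x m := by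
    filter_upwards [eventually_gt_atTop m] with k hk using step m k hk
  exact tendsto_nhds_unique (tendsto_const_nhds.congr' hev.symm) hx.1

/-- The vector space underlying James' space. -/
def jamesSubmodule : Submodule ℝ (ℕ → ℝ) where
  carrier := {x | IsJamesSeq x}
  zero_mem' := by
    refine ⟨tendsto_const_nhds, 0, ?_⟩
    rintro _ ⟨n, p, -, rfl⟩
    simp [jamesSum]
  add_mem' := by
    rintro x y ⟨hx, hx'⟩ ⟨hy, hy'⟩
    refine ⟨by rw [← add_zero (0 : ℝ)]; exact hx.add hy, (jamesNorm x + jamesNorm y) ^ 2, ?_⟩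
    rintro _ ⟨n, p, hp, rfl⟩
    exact jamesSum_add_le_sq hx' hy' n hp
  smul_mem' := by
    rintro c x ⟨hx, hx'⟩
    exact ⟨by rw [← smul_zero c]; exact hx.const_smul c, bddAbove_jamesSums_smul c hx'⟩

/-- James' space `J`. It is a type of its own, since the submodule `jamesSubmodule` already
carries the topology of coordinatewise convergence as an instance. -/
def JamesSpace : Type := jamesSubmodule

namespace JamesSpace

/-- The sequence of coordinates of an element of `J`. -/
def coord (x : JamesSpace) : ℕ → ℝ := Subtype.val x

instance : AddCommGroup JamesSpace := inferInstanceAs (AddCommGroup jamesSubmodule)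

instance : Module ℝ JamesSpace := inferInstanceAs (Module ℝ jamesSubmodule)

instance : Norm JamesSpace := ⟨fun x => jamesNorm x.coord⟩

theorem normedSpaceCore : NormedSpace.Core ℝ JamesSpace where
  norm_nonneg _ := Real.sqrt_nonneg _
  norm_smul c x := jamesNorm_smul c (Subtype.property x).2
  norm_triangle x y := jamesNorm_add_le (Subtype.property x).2 (Subtype.property y).2
  norm_eq_zero_iff x := by
    refine ⟨fun h => Subtype.ext (eq_zero_of_jamesNorm_eq_zero (Subtype.property x) h), ?_⟩
    rintro rfl
    have h := jamesNorm_smul 0 (zero_mem jamesSubmodule : IsJamesSeq 0).2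
    rw [zero_smul, abs_zero, zero_mul] at h
    exact h

instance : NormedAddCommGroup JamesSpace := NormedAddCommGroup.ofCore normedSpaceCore

instance : NormedSpace ℝ JamesSpace := NormedSpace.ofCore normedSpaceCore

end JamesSpace

/-! ### Weakly compact operators -/

section WeaklyCompact

variable {E F G : Type*} [NormedAddCommGroup E] [NormedSpace ℝ E]
  [NormedAddCommGroup F] [NormedSpace ℝ F] [NormedAddCommGroup G] [NormedSpace ℝ G]

/-- A bounded operator is weakly compact if the image of the closed unit ball is relatively compact
in the weak topology. -/
def IsWeaklyCompactOperator (T : E →L[ℝ] F) : Prop :=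
  IsCompact (closure (toWeakSpace ℝ F '' (T '' Metric.closedBall 0 1)))

theorem IsWeaklyCompactOperator.of_subset {T : E →L[ℝ] F} {K : Set (WeakSpace ℝ F)}
    (hK : IsCompact K) (h : ∀ x ∈ Metric.closedBall (0 : E) 1, toWeakSpace ℝ F (T x) ∈ K) :
    IsWeaklyCompactOperator T := by
  refine hK.closure_of_subset ?_
  rintro _ ⟨_, ⟨x, hx, rfl⟩, rfl⟩
  exact h x hx

theorem IsWeaklyCompactOperator.mem {T : E →L[ℝ] F} {x : E}
    (hx : x ∈ Metric.closedBall (0 : E) 1) :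
    toWeakSpace ℝ F (T x) ∈ closure (toWeakSpace ℝ F '' (T '' Metric.closedBall 0 1)) :=
  subset_closure ⟨_, ⟨x, hx, rfl⟩, rfl⟩

theorem isWeaklyCompactOperator_zero : IsWeaklyCompactOperator (0 : E →L[ℝ] F) :=
  .of_subset (isCompact_singleton (x := 0)) (by simp)

theorem IsWeaklyCompactOperator.add {S T : E →L[ℝ] F} (hS : IsWeaklyCompactOperator S)
    (hT : IsWeaklyCompactOperator T) : IsWeaklyCompactOperator (S + T) := by
  refine .of_subset ((hS.prod hT).image continuous_add) fun x hx => ?_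
  exact ⟨(_, _), ⟨mem (T := S) hx, mem (T := T) hx⟩, by simp⟩

theorem IsWeaklyCompactOperator.smul (c : ℝ) {T : E →L[ℝ] F} (hT : IsWeaklyCompactOperator T) :
    IsWeaklyCompactOperator (c • T) := by
  refine .of_subset (hT.image (continuous_const_smul c)) fun x hx => ?_
  exact ⟨_, mem (T := T) hx, by simp⟩

theorem IsWeaklyCompactOperator.comp_left (S : F →L[ℝ] G) {T : E →L[ℝ] F}
    (hT : IsWeaklyCompactOperator T) : IsWeaklyCompactOperator (S.comp T) := by
  refine .of_subset (hT.image (WeakSpace.map S).continuous) fun x hx => ?_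
  exact ⟨_, mem (T := T) hx, rfl⟩

variable (E) in
/-- The algebra `W(E)` of weakly compact operators on `E`, with composition as multiplication and
the operator norm (both inherited from `E →L[ℝ] E`). -/
def weaklyCompactOperators : NonUnitalSubalgebra ℝ (E →L[ℝ] E) where
  carrier := {T | IsWeaklyCompactOperator T}
  zero_mem' := isWeaklyCompactOperator_zero
  add_mem' hS hT := hS.add hT
  smul_mem' c _ hT := hT.smul c
  mul_mem' {S _} _ hT := hT.comp_left S

end WeaklyCompact

/-! ### Bounded left approximate identities -/

/-- A normed algebra `A` has a bounded left approximate identity if there is a bounded net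
`(x_α)` in `A` with `lim_α ‖y - x_α y‖ = 0` for every `y ∈ A`. -/
def HasBoundedLeftApproxIdentity.{u} (A : Type u) [NonUnitalNormedRing A] : Prop :=
  ∃ (ι : Type u) (_ : Preorder ι) (_ : IsDirectedOrder ι) (_ : Nonempty ι) (x : ι → A),
    (∃ C : ℝ, ∀ α, ‖x α‖ ≤ C) ∧
      ∀ y : A, Tendsto (fun α => ‖y - x α * y‖) atTop (𝓝 0)

end

/-! ### Square variation of sequences -/

/-! Reading off coordinates identifies `J**` with the sequences of finite square variation, null or
not: `J` plus the line through the constant sequence `1`, called `σ`. This rests on the basis being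
shrinking (`shrinking`, `bidual_ext`). If the second adjoint of an operator `A` on `J` maps `J**`
into `J`, then the adjoint `A*` is weakly compact. It therefore suffices to find, for each weakly
compact convex `K` in `J*`, such an `A` of norm at most `3` with `A*` uniformly close to the
identity on `K ∩ -K`.

Take `A = I - RQ`, where `Q` kills the first coordinate and `R` samples the piecewise linear
interpolation of a sequence at nondecreasing points `u i → ∞`. Interpolation averages monotone
reindexings, so `R` is a contraction (`jamesSum_interp_le`). Since `R` and `Q` preserve limits, the
second adjoint of `A` produces null sequences, that is, elements of `J`.

The points `u i` are adapted to `K`. The functionals `σ - initial j` tend to `0` pointwise on `J*`,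
so convex combinations over successive blocks are as small as desired on `K`
(`exists_block_weights`). With `u` the partial sums of these weights, `R (initial (m + 1))` is
exactly the convex combination over block `m` (`resample_initial_succ`). Hence each `φ` in `K ∩ -K`
nearly vanishes on differences of successive `R (initial m)`, `m ≥ 1`, and `φ - A* φ = φ ∘ RQ` is
small by summation. -/

theorem jamesSum_succ (x : ℕ → ℝ) (n : ℕ) (p : ℕ → ℕ) :
    jamesSum x (n + 1) p = |x (p 1) - x (p 0)| ^ 2 + jamesSum x n (fun j => p (j + 1)) := by
  simp only [jamesSum, Finset.sum_range_succ', add_comm, zero_add]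

theorem jamesSum_add_right (x : ℕ → ℝ) (m n : ℕ) (p : ℕ → ℕ) :
    jamesSum x (m + n) p = jamesSum x m p + jamesSum x n (fun j => p (m + j)) := by
  simp only [jamesSum, Finset.sum_range_add, add_assoc]

theorem jamesSum_congr {x y : ℕ → ℝ} {n : ℕ} {p : ℕ → ℕ} (hp : Monotone p)
    (h : ∀ i, p 0 ≤ i → x i = y i) : jamesSum x n p = jamesSum y n p :=
  Finset.sum_congr rfl fun j _ => by rw [h _ (hp (Nat.zero_le _)), h _ (hp (Nat.zero_le _))]

theorem strictMono_comp_succ {p : ℕ → ℕ} (hp : StrictMono p) : StrictMono fun j => p (j + 1) :=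
  fun _ _ h => hp (Nat.succ_lt_succ h)

/-- The sequence `x` with its first `M` entries replaced by `0`. -/
def tailSeq (M : ℕ) (x : ℕ → ℝ) : ℕ → ℝ := fun i => if i < M then 0 else x i

/-- An increasing chain of indices crosses `M` at most once; that jump goes from `0` to some `x i`
and costs at most `δ`. -/
theorem jamesSum_tailSeq_le {x : ℕ → ℝ} {M : ℕ} {B δ : ℝ}
    (hB : ∀ m q, StrictMono q → M ≤ q 0 → jamesSum x m q ≤ B)
    (hδ : ∀ i, M ≤ i → |x i| ^ 2 ≤ δ) (m : ℕ) (q : ℕ → ℕ) (hq : StrictMono q) :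
    jamesSum (tailSeq M x) m q ≤ B + δ := by
  have hB0 : 0 ≤ B := by
    simpa [jamesSum] using hB 0 (fun j => M + j) (fun a b h => by simpa using h) (by simp)
  have hδ0 : 0 ≤ δ := (sq_nonneg _).trans (hδ M le_rfl)
  have hlarge : ∀ m q, StrictMono q → M ≤ q 0 → jamesSum (tailSeq M x) m q ≤ B := by
    intro m q hq h0
    rw [jamesSum_congr (y := x) hq.monotone fun i hi => by simp [tailSeq, (h0.trans hi).not_gt]]
    exact hB m q hq h0
  induction m generalizing q with
  | zero => simpa [jamesSum] using add_nonneg hB0 hδ0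
  | succ m ih =>
    by_cases h0 : q 0 < M
    · rw [jamesSum_succ]
      by_cases h1 : q 1 < M
      · simpa [tailSeq, h0, h1] using ih _ (strictMono_comp_succ hq)
      · have e1 := hlarge m _ (strictMono_comp_succ hq) (not_lt.1 h1)
        have e2 := hδ _ (not_lt.1 h1)
        have e3 : |tailSeq M x (q 1) - tailSeq M x (q 0)| ^ 2 ≤ δ := by
          simpa [tailSeq, h0, h1] using e2
        linarith
    · linarith [hlarge (m + 1) q hq (not_lt.1 h0)]

/-- A chain `p` whose sum is within `ε` of the supremum leaves at most `ε` for any chain appended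
beyond it. The jump joining the two chains is nonnegative and is dropped. -/
theorem exists_jamesSum_tail_le {x : ℕ → ℝ} (hx : BddAbove (jamesSums x)) {ε : ℝ} (hε : 0 < ε) :
    ∃ N, ∀ m q, StrictMono q → N ≤ q 0 → jamesSum x m q ≤ ε := by
  obtain ⟨_, ⟨n, p, hp, rfl⟩, hs⟩ :=
    exists_lt_of_lt_csSup ⟨0, zero_mem_jamesSums x⟩ (sub_lt_self (sSup (jamesSums x)) hε)
  refine ⟨p n + 1, fun m q hq h0 => ?_⟩
  set r : ℕ → ℕ := fun j => if j ≤ n then p j else q (j - (n + 1)) with hr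
  have hrm : StrictMono r := by
    refine strictMono_nat_of_lt_succ fun j => ?_
    simp only [hr]
    split_ifs with h1 h2 h2
    · exact hp (Nat.lt_succ_self j)
    · have : j = n := by omega
      subst this
      simpa using h0
    · omega
    · exact hq (by omega)
  have h1 := le_csSup hx ⟨n + 1 + m, r, hrm, rfl⟩
  rw [jamesSum_add_right, jamesSum_add_right] at h1
  have e1 : jamesSum x n r = jamesSum x n p := by
    refine Finset.sum_congr rfl fun j hj => ?_
    have := Finset.mem_range.1 hj
    simp only [hr]
    rw [if_pos (by omega), if_pos (by omega)]
  have e2 : jamesSum x m (fun j => r (n + 1 + j)) = jamesSum x m q := by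
    refine Finset.sum_congr rfl fun j hj => ?_
    simp only [hr]
    rw [if_neg (by omega), if_neg (by omega)]
    congr 5 <;> omega
  have e3 := jamesSum_nonneg x 1 (fun j => r (n + j))
  linarith

theorem cauchySeq_of_bddAbove_jamesSums {x : ℕ → ℝ} (hx : BddAbove (jamesSums x)) :
    CauchySeq x := by
  refine Metric.cauchySeq_iff'.2 fun ε hε => ?_
  obtain ⟨N, hN⟩ := exists_jamesSum_tail_le hx (ε := (ε / 2) ^ 2) (by positivity)
  refine ⟨N, fun n hn => ?_⟩
  rcases hn.eq_or_lt with rfl | hlt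
  · simpa using hε
  · have h := hN 1 (fun j => N + j * (n - N))
      (fun a b hab => by
        have := Nat.mul_lt_mul_of_pos_right hab (show 0 < n - N by omega)
        simpa using this) (by simp)
    have e : N + (n - N) = n := by omega
    simp only [jamesSum, Finset.sum_range_one, zero_add, one_mul, zero_mul, add_zero, e] at h
    have := abs_le_of_sq_le_sq' (by simpa using h) (by positivity : 0 ≤ ε / 2)
    rw [Real.dist_eq, abs_lt]
    constructor <;> linarith [this.1, this.2]

/-- Sequences with consecutive supports are almost orthogonal for the square variation. -/
theorem jamesSum_add_le_of_consecutive {x y : ℕ → ℝ} {a : ℕ} {c d : ℝ}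
    (hx : ∀ i, a ≤ i → x i = 0) (hy : ∀ i, i < a → y i = 0) (hc : ∀ i, |x i| ≤ c)
    (hd : ∀ i, |y i| ≤ d) (n : ℕ) (p : ℕ → ℕ) (hp : StrictMono p) :
    jamesSum (x + y) n p ≤ jamesSum x n p + jamesSum y n p + 2 * (c * d) := by
  have hcd : 0 ≤ c * d :=
    mul_nonneg ((abs_nonneg _).trans (hc 0)) ((abs_nonneg _).trans (hd 0))
  have hlarge : ∀ n p, StrictMono p → a ≤ p 0 → jamesSum (x + y) n p = jamesSum y n p :=
    fun n p hp h0 => jamesSum_congr hp.monotone fun i hi => by simp [hx i (h0.trans hi)]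
  induction n generalizing p with
  | zero => simpa [jamesSum] using hcd
  | succ n ih =>
    by_cases h0 : p 0 < a
    · have ih' := ih _ (strictMono_comp_succ hp)
      rw [jamesSum_succ, jamesSum_succ x, jamesSum_succ y]
      simp only [Pi.add_apply, sq_abs] at ih' ⊢
      by_cases h1 : p 1 < a
      · rw [hy _ h0, hy _ h1]
        linarith
      -- This is the only jump crossing `a`: its square is that of the two separate jumps minus
      -- twice a product, so `2 * (c * d)` is paid once.
      · have e := hlarge n _ (strictMono_comp_succ hp) (not_lt.1 h1)
        rw [hy _ h0, hx _ (not_lt.1 h1), e]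
        have e2 := jamesSum_nonneg x n fun j => p (j + 1)
        have e3 : |x (p 0) * y (p 1)| ≤ c * d := by
          rw [abs_mul]
          exact mul_le_mul (hc _) (hd _) (abs_nonneg _) ((abs_nonneg _).trans (hc 0))
        nlinarith [(abs_le.1 e3).1]
    · rw [hlarge _ p hp (not_lt.1 h0)]
      linarith [jamesSum_nonneg x (n + 1) p]

/-! ### Elements of `J`, coordinates and tail operators. -/

namespace JamesSpace

theorem isJamesSeq_coord (x : JamesSpace) : IsJamesSeq x.coord := Subtype.property x

/-- The element of `J` with given coordinates. -/
def mk (x : ℕ → ℝ) (hx : IsJamesSeq x) : JamesSpace := (⟨x, hx⟩ : jamesSubmodule)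

@[simp] theorem coord_mk (x : ℕ → ℝ) (hx : IsJamesSeq x) : (mk x hx).coord = x := rfl

@[simp] theorem coord_add (x y : JamesSpace) : (x + y).coord = x.coord + y.coord := rfl

@[simp] theorem coord_sub (x y : JamesSpace) : (x - y).coord = x.coord - y.coord := rfl

@[simp] theorem coord_smul (c : ℝ) (x : JamesSpace) : (c • x).coord = c • x.coord := rfl

theorem coord_injective : Function.Injective coord := Subtype.val_injective

theorem jamesSum_coord_le (x : JamesSpace) (n : ℕ) {p : ℕ → ℕ} (hp : StrictMono p) :
    jamesSum x.coord n p ≤ ‖x‖ ^ 2 :=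
  (Real.sqrt_le_iff.1 (sqrt_jamesSum_le x.isJamesSeq_coord.2 n hp)).2

theorem norm_sq_le {x : JamesSpace} {C : ℝ}
    (h : ∀ n p, StrictMono p → jamesSum x.coord n p ≤ C) : ‖x‖ ^ 2 ≤ C := by
  have h0 : 0 ≤ sSup (jamesSums x.coord) :=
    le_csSup x.isJamesSeq_coord.2 (zero_mem_jamesSums _)
  have e : ‖x‖ ^ 2 = sSup (jamesSums x.coord) := Real.sq_sqrt h0
  rw [e]
  refine csSup_le ⟨0, zero_mem_jamesSums _⟩ ?_
  rintro _ ⟨n, p, hp, rfl⟩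
  exact h n p hp

theorem abs_coord_le (x : JamesSpace) (i : ℕ) : |x.coord i| ≤ ‖x‖ := by
  have h : ∀ᶠ k in atTop, |x.coord k - x.coord i| ≤ ‖x‖ := by
    filter_upwards [eventually_gt_atTop i] with k hk
    have h := x.jamesSum_coord_le 1 (p := fun j => i + j * (k - i)) (fun a b hab => by
        have := Nat.mul_lt_mul_of_pos_right hab (show 0 < k - i by omega)
        simpa using this)
    have e : i + (k - i) = k := by omega
    simp only [jamesSum, Finset.sum_range_one, zero_add, one_mul, zero_mul, add_zero, e] at h
    exact abs_le_of_sq_le_sq (by simpa using h) (norm_nonneg _)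
  have h2 := le_of_tendsto ((x.isJamesSeq_coord.1.sub_const (x.coord i)).abs) h
  simpa using h2

/-- The coordinate functionals on `J`. -/
noncomputable def coordCLM (i : ℕ) : StrongDual ℝ JamesSpace :=
  LinearMap.mkContinuous
    { toFun := fun x => x.coord i
      map_add' := fun _ _ => rfl
      map_smul' := fun _ _ => rfl } 1 fun x => by rw [one_mul]; exact x.abs_coord_le i

@[simp] theorem coordCLM_apply (i : ℕ) (x : JamesSpace) : coordCLM i x = x.coord i := rfl

theorem coord_sum {ι : Type*} (s : Finset ι) (f : ι → JamesSpace) (i : ℕ) :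
    (∑ j ∈ s, f j).coord i = ∑ j ∈ s, (f j).coord i :=
  map_sum (coordCLM i) f s

theorem isJamesSeq_tailSeq (M : ℕ) (x : JamesSpace) : IsJamesSeq (tailSeq M x.coord) := by
  refine ⟨x.isJamesSeq_coord.1.congr' ?_, ‖x‖ ^ 2 + ‖x‖ ^ 2, ?_⟩
  · filter_upwards [eventually_ge_atTop M] with i hi
    simp [tailSeq, hi.not_gt]
  · rintro _ ⟨n, p, hp, rfl⟩
    exact jamesSum_tailSeq_le (fun m q hq _ => x.jamesSum_coord_le m hq)
      (fun i _ => pow_le_pow_left₀ (abs_nonneg _) (x.abs_coord_le i) 2) n p hp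

/-- The element of `J` obtained from `x` by replacing the first `M` coordinates by `0`. -/
def tail (M : ℕ) (x : JamesSpace) : JamesSpace := mk _ (isJamesSeq_tailSeq M x)

theorem coord_tail (M : ℕ) (x : JamesSpace) (i : ℕ) :
    (tail M x).coord i = if i < M then 0 else x.coord i := rfl

theorem norm_tail_le (M : ℕ) (x : JamesSpace) : ‖tail M x‖ ≤ 2 * ‖x‖ := by
  refine (le_abs_self _).trans (abs_le_of_sq_le_sq ?_ (by positivity))
  refine (norm_sq_le fun n p hp => ?_).trans (by nlinarith [sq_nonneg ‖x‖] : ‖x‖ ^ 2 + ‖x‖ ^ 2 ≤ _)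
  exact jamesSum_tailSeq_le (fun m q hq _ => x.jamesSum_coord_le m hq)
      (fun i _ => pow_le_pow_left₀ (abs_nonneg _) (x.abs_coord_le i) 2) n p hp

theorem tendsto_norm_tail (x : JamesSpace) : Tendsto (fun M => ‖tail M x‖) atTop (𝓝 0) := by
  refine Metric.tendsto_atTop.2 fun ε hε => ?_
  obtain ⟨N, hN⟩ := exists_jamesSum_tail_le x.isJamesSeq_coord.2 (ε := ε ^ 2 / 4) (by positivity)
  obtain ⟨N', hN'⟩ := Metric.tendsto_atTop.1 x.isJamesSeq_coord.1 (ε / 2) (by positivity)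
  refine ⟨max N N', fun M hM => ?_⟩
  have h : ‖tail M x‖ ^ 2 ≤ ε ^ 2 / 4 + ε ^ 2 / 4 := by
    refine norm_sq_le fun n p hp => ?_
    refine jamesSum_tailSeq_le (fun m q hq h => hN m q hq ((le_max_left _ _).trans (hM.trans h)))
      (fun i hi => ?_) n p hp
    have := (hN' i ((le_max_right _ _).trans (hM.trans hi))).le
    rw [Real.dist_eq, sub_zero] at this
    calc |x.coord i| ^ 2 ≤ (ε / 2) ^ 2 := pow_le_pow_left₀ (abs_nonneg _) this 2
      _ = ε ^ 2 / 4 := by ring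
  rw [Real.dist_eq, sub_zero, abs_of_nonneg (norm_nonneg _)]
  refine lt_of_pow_lt_pow_left₀ 2 hε.le (h.trans_lt ?_)
  nlinarith [sq_pos_of_pos hε]

/-! ### The unit vectors form a shrinking basis of `J` -/

theorem jamesSum_indicator_le (n m : ℕ) (p : ℕ → ℕ) (hp : StrictMono p) :
    jamesSum (fun i => if i < n then 1 else 0) m p ≤ 1 := by
  have e : jamesSum (fun i => if i < n then 1 else 0) m p =
      jamesSum (tailSeq n fun _ => 1) m p := by
    refine Finset.sum_congr rfl fun j _ => ?_
    simp only [tailSeq]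
    split_ifs <;> simp
  rw [e]
  simpa using jamesSum_tailSeq_le (x := fun _ => 1) (M := n) (B := 0) (δ := 1)
    (fun m q _ _ => by simp [jamesSum]) (by simp) m p hp

/-- The indicator function of `{0, …, n - 1}` as an element of `J`. -/
def initial (n : ℕ) : JamesSpace :=
  mk (fun i => if i < n then 1 else 0) (by
    refine ⟨tendsto_const_nhds.congr' ?_, 1, ?_⟩
    · filter_upwards [eventually_ge_atTop n] with i hi
      simp [hi.not_gt]
    · rintro _ ⟨m, p, hp, rfl⟩
      exact jamesSum_indicator_le n m p hp)

theorem coord_initial (n i : ℕ) : (initial n).coord i = if i < n then 1 else 0 := rfl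

theorem norm_initial_le (n : ℕ) : ‖initial n‖ ≤ 1 := by
  have h : ‖initial n‖ ^ 2 ≤ 1 := norm_sq_le fun m p hp => jamesSum_indicator_le n m p hp
  exact (sq_le_one_iff₀ (norm_nonneg _)).1 h

theorem coord_initial_succ_sub (n i : ℕ) :
    (initial (n + 1) - initial n).coord i = if n = i then 1 else 0 := by
  simp only [coord_sub, Pi.sub_apply, coord_initial]
  split_ifs <;> first | omega | simp

theorem sub_tail (n : ℕ) (x : JamesSpace) :
    x - tail n x = ∑ i ∈ Finset.range n, x.coord i • (initial (i + 1) - initial i) := by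
  refine coord_injective (funext fun j => ?_)
  simp only [coord_sum, coord_smul, Pi.smul_apply, coord_initial_succ_sub, smul_eq_mul, mul_ite,
    mul_one, mul_zero, Finset.sum_ite_eq', Finset.mem_range]
  simp only [coord_sub, Pi.sub_apply, coord_tail]
  split_ifs <;> simp

theorem tendsto_sub_tail (x : JamesSpace) : Tendsto (fun n => x - tail n x) atTop (𝓝 x) := by
  have h := (tendsto_zero_iff_norm_tendsto_zero.2 x.tendsto_norm_tail).const_sub x
  rwa [sub_zero] at h

theorem coord_sub_tail (n : ℕ) (x : JamesSpace) (i : ℕ) :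
    (x - tail n x).coord i = if i < n then x.coord i else 0 := by
  simp only [coord_sub, Pi.sub_apply, coord_tail]
  split_ifs <;> simp

theorem coord_tail_of_lt {M i : ℕ} (x : JamesSpace) (h : i < M) : (tail M x).coord i = 0 := by
  simp [coord_tail, h]

/-- A functional on `J` is uniformly small on the vectors with late support. -/
theorem shrinking (φ : StrongDual ℝ JamesSpace) {ε : ℝ} (hε : 0 < ε) :
    ∃ N, ∀ x : JamesSpace, (∀ i < N, x.coord i = 0) → |φ x| ≤ ε * ‖x‖ := by
  by_contra! hcon
  -- A counterexample vector may be truncated, by continuity of `φ`, and then normalised with the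
  -- sign of `φ`.
  have block : ∀ N, ∃ (y : JamesSpace) (a : ℕ), (∀ i < N, y.coord i = 0) ∧
      (∀ i, a ≤ i → y.coord i = 0) ∧ ‖y‖ ≤ 1 ∧ ε ≤ φ y := by
    intro N
    obtain ⟨x, hx0, hx⟩ := hcon N
    have h1 : Tendsto (fun n => |φ (x - tail n x)|) atTop (𝓝 |φ x|) :=
      ((φ.continuous.tendsto x).comp x.tendsto_sub_tail).abs
    have h2 : Tendsto (fun n => ε * ‖x - tail n x‖) atTop (𝓝 (ε * ‖x‖)) :=
      x.tendsto_sub_tail.norm.const_mul ε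
    obtain ⟨a, ha⟩ := (h2.eventually_lt h1 hx).exists
    set z := x - tail a x with hz
    have hz0 : ∀ i < N, z.coord i = 0 := fun i hi => by
      rw [hz, coord_sub_tail, hx0 i hi, ite_self]
    have hza : ∀ i, a ≤ i → z.coord i = 0 := fun i hi => by
      rw [hz, coord_sub_tail, if_neg hi.not_gt]
    have hφz : 0 < |φ z| := (mul_nonneg hε.le (norm_nonneg z)).trans_lt ha
    have hpos : 0 < ‖z‖ := norm_pos_iff.2 fun h => by simp [h] at hφz
    refine ⟨(SignType.sign (φ z) * ‖z‖⁻¹ : ℝ) • z, a, fun i hi => ?_, fun i hi => ?_, ?_, ?_⟩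
    · simp [hz0 i hi]
    · simp [hza i hi]
    · rw [norm_smul, norm_mul, norm_inv, norm_norm, mul_assoc, inv_mul_cancel₀ hpos.ne', mul_one]
      rcases lt_trichotomy (φ z) 0 with h | h | h <;> simp [h]
    · rw [map_smul, smul_eq_mul, mul_right_comm, sign_mul_self, ← div_eq_mul_inv, le_div_iff₀ hpos]
      exact ha.le
  -- Each new block adds at most `1 + 2 * (1 * 1) = 3` to the squared norm. So `k` blocks have norm
  -- of order `√k`, while `φ` grows like `ε * k`.
  have sums : ∀ k : ℕ, ∃ (S : JamesSpace) (a : ℕ), (∀ i, a ≤ i → S.coord i = 0) ∧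
      (∀ i, |S.coord i| ≤ 1) ∧ ‖S‖ ^ 2 ≤ 3 * k ∧ ε * k ≤ φ S := by
    intro k
    induction k with
    | zero => exact ⟨0, 0, fun _ _ => rfl, fun i => by
        change |(0 : ℝ)| ≤ 1
        simp, by simp, by simp⟩
    | succ k ih =>
      obtain ⟨S, a, hSa, hS1, hSn, hSφ⟩ := ih
      obtain ⟨y, b, hya, hyb, hyn, hyφ⟩ := block a
      have hy1 : ∀ i, |y.coord i| ≤ 1 := fun i => (y.abs_coord_le i).trans hyn
      refine ⟨S + y, max a b, fun i hi => ?_, fun i => ?_, ?_, ?_⟩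
      · simp [hSa i ((le_max_left _ _).trans hi), hyb i ((le_max_right _ _).trans hi)]
      · rcases lt_or_ge i a with h | h
        · simpa [hya i h] using hS1 i
        · simpa [hSa i h] using hy1 i
      · refine norm_sq_le fun n p hp => ?_
        have h := jamesSum_add_le_of_consecutive hSa hya hS1 hy1 n p hp
        have h1 := S.jamesSum_coord_le n hp
        have h2 := y.jamesSum_coord_le n hp
        have h3 : ‖y‖ ^ 2 ≤ 1 := pow_le_one₀ (norm_nonneg _) hyn
        rw [coord_add]
        push_cast
        linarith
      · rw [map_add]
        push_cast
        linarith
  obtain ⟨k, hk⟩ := exists_nat_gt (3 * ‖φ‖ ^ 2 / ε ^ 2)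
  obtain ⟨S, a, -, -, hSn, hSφ⟩ := sums k
  have hk0 : (0 : ℝ) < k := lt_of_le_of_lt (by positivity) hk
  rw [div_lt_iff₀ (by positivity)] at hk
  have h1 : φ S ≤ ‖φ‖ * ‖S‖ := (le_abs_self _).trans (φ.le_opNorm S)
  have h2 : (ε * k) ^ 2 ≤ (‖φ‖ * ‖S‖) ^ 2 :=
    pow_le_pow_left₀ (by positivity) (hSφ.trans h1) 2
  have h3 : ‖φ‖ ^ 2 * ‖S‖ ^ 2 ≤ ‖φ‖ ^ 2 * (3 * k) := by gcongr
  nlinarith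

/-- Two functionals on the dual of `J` agree if they agree on the coordinate functionals. -/
theorem bidual_ext {Ψ Θ : StrongDual ℝ (StrongDual ℝ JamesSpace)}
    (h : ∀ i, Ψ (coordCLM i) = Θ (coordCLM i)) : Ψ = Θ := by
  ext φ
  let P : ℕ → StrongDual ℝ JamesSpace := fun n =>
    ∑ i ∈ Finset.range n, φ (initial (i + 1) - initial i) • coordCLM i
  have hP : ∀ n x, P n x = φ (x - tail n x) := by
    intro n x
    rw [sub_tail]
    simp [P, mul_comm]
  -- The coordinate functionals span a norm dense subspace. The quarter of `ε` absorbs the factor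
  -- `2` of `norm_tail_le`.
  have hlim : Tendsto P atTop (𝓝 φ) := by
    refine Metric.tendsto_atTop.2 fun ε hε => ?_
    obtain ⟨N, hN⟩ := shrinking φ (ε := ε / 4) (by positivity)
    refine ⟨N, fun n hn => ?_⟩
    rw [dist_comm, dist_eq_norm]
    refine (ContinuousLinearMap.opNorm_le_bound _ (by positivity : 0 ≤ ε / 2) fun x => ?_).trans_lt
      (half_lt_self hε)
    have e : (φ - P n) x = φ (tail n x) := by
      rw [sub_apply, hP, map_sub]
      ring
    rw [e, Real.norm_eq_abs]
    refine (hN _ fun i hi => coord_tail_of_lt x (hi.trans_le hn)).trans ?_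
    nlinarith [norm_tail_le n x]
  have e : ∀ n, Ψ (P n) = Θ (P n) := fun n => by simp [P, h]
  refine tendsto_nhds_unique ((Ψ.continuous.tendsto φ).comp hlim) ?_
  refine ((Θ.continuous.tendsto φ).comp hlim).congr fun n => (e n).symm

/-- The coordinates of an element of the bidual of `J` have finite square variation. -/
theorem bddAbove_jamesSums_bidual (Ψ : StrongDual ℝ (StrongDual ℝ JamesSpace)) :
    BddAbove (jamesSums fun i => Ψ (coordCLM i)) := by
  refine ⟨‖Ψ‖ ^ 2, ?_⟩
  rintro _ ⟨n, p, hp, rfl⟩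
  set s := jamesSum (fun i => Ψ (coordCLM i)) n p with hs
  have hs0 : 0 ≤ s := jamesSum_nonneg _ _ _
  set a : ℕ → ℝ := fun j => Ψ (coordCLM (p (j + 1))) - Ψ (coordCLM (p j)) with ha
  -- The extremal case of Cauchy–Schwarz: `Ψ φ` is the whole sum `s`, while `‖φ‖ ≤ √s`.
  let φ : StrongDual ℝ JamesSpace :=
    ∑ j ∈ Finset.range n, a j • (coordCLM (p (j + 1)) - coordCLM (p j))
  have h1 : Ψ φ = s := by
    simp only [φ, map_sum, map_smul, map_sub, hs, jamesSum, sq_abs, smul_eq_mul]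
    exact Finset.sum_congr rfl fun j _ => by simp only [ha]; ring
  have h2 : ‖φ‖ ≤ √s := by
    refine ContinuousLinearMap.opNorm_le_bound _ (Real.sqrt_nonneg _) fun x => ?_
    have e : φ x = ∑ j ∈ Finset.range n, a j * (x.coord (p (j + 1)) - x.coord (p j)) := by
      simp [φ]
    have hx := Real.sqrt_le_iff.2 ⟨norm_nonneg x, x.jamesSum_coord_le n hp⟩
    have hCS := Finset.sum_mul_sq_le_sq_mul_sq (Finset.range n) a
      (fun j => x.coord (p (j + 1)) - x.coord (p j))
    rw [e, Real.norm_eq_abs]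
    refine abs_le_of_sq_le_sq ?_ (by positivity)
    rw [mul_pow, Real.sq_sqrt hs0]
    refine hCS.trans ?_
    have e1 : ∑ j ∈ Finset.range n, a j ^ 2 = s := by simp [hs, jamesSum, ha]
    have e2 := x.jamesSum_coord_le n hp
    simp only [jamesSum, sq_abs] at e2
    rw [e1]
    gcongr
  have h3 : s ≤ ‖Ψ‖ * √s := by
    calc s = Ψ φ := h1.symm
      _ ≤ ‖Ψ‖ * ‖φ‖ := (le_abs_self _).trans (Ψ.le_opNorm φ)
      _ ≤ _ := by gcongr
  have h4 : √s ≤ ‖Ψ‖ := by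
    by_contra! h
    have := Real.mul_self_sqrt hs0
    nlinarith [norm_nonneg Ψ]
  exact (Real.sqrt_le_iff.1 h4).2

/-- The functional on the dual of `J` which corresponds to the constant sequence `1`. -/
theorem exists_bidual_one : ∃ σ : StrongDual ℝ (StrongDual ℝ JamesSpace),
    ∀ φ, Tendsto (fun n => φ (initial n)) atTop (𝓝 (σ φ)) := by
  -- `initial n - initial N` is supported beyond `N` and has norm at most `2`, so `shrinking`
  -- applies.
  have hc : ∀ φ : StrongDual ℝ JamesSpace, CauchySeq fun n => φ (initial n) := by
    intro φ
    refine Metric.cauchySeq_iff'.2 fun ε hε => ?_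
    obtain ⟨N, hN⟩ := shrinking φ (ε := ε / 3) (by positivity)
    refine ⟨N, fun n hn => ?_⟩
    rw [Real.dist_eq, ← map_sub]
    have h1 : ‖initial n - initial N‖ ≤ 2 := by
      linarith [norm_sub_le (initial n) (initial N), norm_initial_le n, norm_initial_le N]
    have h2 := hN (initial n - initial N) fun i hi => by
      simp [coord_initial, hi, hi.trans_le hn]
    nlinarith
  choose f hf using fun φ => cauchySeq_tendsto_of_complete (hc φ)
  let g : ℕ → StrongDual ℝ JamesSpace →L[ℝ] ℝ := fun n =>
    NormedSpace.inclusionInDoubleDual ℝ JamesSpace (initial n)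
  have hg : Tendsto (fun n φ => g n φ) atTop (𝓝 f) := tendsto_pi_nhds.2 hf
  exact ⟨continuousLinearMapOfTendsto g hg, hf⟩

end JamesSpace

/-! ### Piecewise linear interpolation -/

/-- Repeated indices contribute zero jumps and can be deleted. Keeping the initial index lets the
induction prepend one. -/
theorem exists_strictMono_jamesSum_eq (x : ℕ → ℝ) (n : ℕ) (q : ℕ → ℕ) (hq : Monotone q) :
    ∃ (m : ℕ) (p : ℕ → ℕ), StrictMono p ∧ p 0 = q 0 ∧ jamesSum x n q = jamesSum x m p := by
  induction n generalizing q with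
  | zero => exact ⟨0, fun j => q 0 + j, fun a b h => by simpa using h, rfl, by simp [jamesSum]⟩
  | succ n ih =>
    obtain ⟨m, p, hp, hp0, hs⟩ := ih (fun j => q (j + 1)) fun a b h => hq (by omega)
    rw [zero_add] at hp0
    rw [jamesSum_succ, hs]
    rcases (hq (Nat.zero_le 1)).eq_or_lt with h | h
    · exact ⟨m, p, hp, by rw [hp0, h], by simp [h]⟩
    · refine ⟨m + 1, fun j => if j = 0 then q 0 else p (j - 1), ?_, by simp, ?_⟩
      · refine strictMono_nat_of_lt_succ fun j => ?_
        rcases j with _ | j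
        · simpa [hp0] using h
        · simpa using hp (Nat.lt_succ_self j)
      · rw [jamesSum_succ]
        simp [hp0]

theorem jamesSum_le_of_monotone {x : ℕ → ℝ} {B : ℝ}
    (h : ∀ n p, StrictMono p → jamesSum x n p ≤ B) (n : ℕ) {q : ℕ → ℕ} (hq : Monotone q) :
    jamesSum x n q ≤ B := by
  obtain ⟨m, p, hp, -, e⟩ := exists_strictMono_jamesSum_eq x n q hq
  exact e ▸ h m p hp

/-- The value at `t` of the piecewise linear function with value `x k` at each natural number
`k`. -/
noncomputable def interp (x : ℕ → ℝ) (t : ℝ) : ℝ :=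
  (1 - (t - ⌊t⌋₊)) * x ⌊t⌋₊ + (t - ⌊t⌋₊) * x (⌊t⌋₊ + 1)

/-- The right endpoint is included because partial sums of weights may reach `k + 1` before block
`k` ends. -/
theorem interp_eq {x : ℕ → ℝ} {t : ℝ} {k : ℕ} (h1 : (k : ℝ) ≤ t) (h2 : t ≤ k + 1) :
    interp x t = (1 - (t - k)) * x k + (t - k) * x (k + 1) := by
  rcases h2.eq_or_lt with rfl | h2
  · have e : ⌊(k : ℝ) + 1⌋₊ = k + 1 := by exact_mod_cast Nat.floor_natCast (R := ℝ) (k + 1)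
    simp [interp, e]
  · have e : ⌊t⌋₊ = k := (Nat.floor_eq_iff ((Nat.cast_nonneg k).trans h1)).2 ⟨h1, h2⟩
    simp [interp, e]

/-- As `s` runs through `[0, 1)`, the floor of `t + s` takes the two neighbouring integer values on
sets whose lengths are the interpolation weights. -/
theorem interp_eq_integral (x : ℕ → ℝ) {t : ℝ} (ht : 0 ≤ t) :
    interp x t = ∫ s in Set.Ico (0 : ℝ) 1, x ⌊t + s⌋₊ := by
  set k := ⌊t⌋₊ with hk
  have h1 : (k : ℝ) ≤ t := Nat.floor_le ht
  have h2 : t < k + 1 := Nat.lt_floor_add_one t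
  have e : Set.Ico (0 : ℝ) 1 = Set.Ico 0 (1 - (t - k)) ∪ Set.Ico (1 - (t - k)) 1 :=
    (Set.Ico_union_Ico_eq_Ico (by linarith) (by linarith)).symm
  have c1 : Set.EqOn (fun s => x ⌊t + s⌋₊) (fun _ => x k) (Set.Ico 0 (1 - (t - k))) := by
    rintro s ⟨hs0, hs1⟩
    have e : ⌊t + s⌋₊ = k :=
      (Nat.floor_eq_iff (by linarith)).2 ⟨by linarith, by linarith⟩
    simp only [e]
  have c2 : Set.EqOn (fun s => x ⌊t + s⌋₊) (fun _ => x (k + 1)) (Set.Ico (1 - (t - k)) 1) := by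
    rintro s ⟨hs0, hs1⟩
    have e : ⌊t + s⌋₊ = k + 1 :=
      (Nat.floor_eq_iff (by linarith)).2 ⟨by push_cast; linarith, by push_cast; linarith⟩
    simp only [e]
  have i1 : MeasureTheory.IntegrableOn (fun s => x ⌊t + s⌋₊) (Set.Ico 0 (1 - (t - k))) :=
    (MeasureTheory.integrableOn_const (by simp)).congr_fun c1.symm measurableSet_Ico
  have i2 : MeasureTheory.IntegrableOn (fun s => x ⌊t + s⌋₊) (Set.Ico (1 - (t - k)) 1) :=
    (MeasureTheory.integrableOn_const (by simp)).congr_fun c2.symm measurableSet_Ico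
  rw [e, MeasureTheory.setIntegral_union (Set.Ico_disjoint_Ico_same) measurableSet_Ico i1 i2,
    MeasureTheory.setIntegral_congr_fun measurableSet_Ico c1,
    MeasureTheory.setIntegral_congr_fun measurableSet_Ico c2]
  simp only [MeasureTheory.setIntegral_const, Real.volume_real_Ico, smul_eq_mul, sub_zero]
  rw [max_eq_left (by linarith), max_eq_left (by linarith), interp, ← hk]
  ring

/-- Nonnegativity of the variance on a probability space. -/
theorem sq_setIntegral_le {g : ℝ → ℝ} (hg : MeasureTheory.IntegrableOn g (Set.Ico (0 : ℝ) 1))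
    (hg2 : MeasureTheory.IntegrableOn (fun s => g s ^ 2) (Set.Ico (0 : ℝ) 1)) :
    (∫ s in Set.Ico (0 : ℝ) 1, g s) ^ 2 ≤ ∫ s in Set.Ico (0 : ℝ) 1, g s ^ 2 := by
  set c := ∫ s in Set.Ico (0 : ℝ) 1, g s with hc
  have h0 : 0 ≤ ∫ s in Set.Ico (0 : ℝ) 1, (g s - c) ^ 2 :=
    MeasureTheory.integral_nonneg fun s => sq_nonneg _
  have e : ∀ s, (g s - c) ^ 2 = g s ^ 2 - 2 * c * g s + c ^ 2 := fun s => by ring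
  simp only [e] at h0
  have i1 : MeasureTheory.IntegrableOn (fun s => 2 * c * g s) (Set.Ico (0 : ℝ) 1) :=
    hg.const_mul _
  have i2 : MeasureTheory.IntegrableOn (fun _ => c ^ 2) (Set.Ico (0 : ℝ) 1) :=
    MeasureTheory.integrableOn_const (by simp)
  have i3 : MeasureTheory.IntegrableOn (fun s => g s ^ 2 - 2 * c * g s) (Set.Ico (0 : ℝ) 1) :=
    hg2.sub i1
  rw [MeasureTheory.integral_add i3 i2, MeasureTheory.integral_sub hg2 i1,
    MeasureTheory.integral_const_mul, ← hc] at h0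
  simp only [MeasureTheory.setIntegral_const, Real.volume_real_Ico, smul_eq_mul, sub_zero] at h0
  norm_num at h0
  linarith

/-- For each fixed shift `s`, sampling at `⌊u i + s⌋₊` is a monotone reindexing and does not
increase square variation. Averaging over `s` preserves the bound by convexity of the square. -/
theorem jamesSum_interp_le {x : ℕ → ℝ} {B K : ℝ} (hK : ∀ i, |x i| ≤ K)
    (h : ∀ n p, StrictMono p → jamesSum x n p ≤ B) {u : ℕ → ℝ} (hu : Monotone u)
    (hu0 : ∀ i, 0 ≤ u i) (n : ℕ) (p : ℕ → ℕ) (hp : StrictMono p) :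
    jamesSum (fun i => interp x (u i)) n p ≤ B := by
  let g : ℕ → ℝ → ℝ := fun i s => x ⌊u i + s⌋₊
  have hgm : ∀ i, Measurable (g i) := fun i =>
    (measurable_from_nat (f := x)).comp (Nat.measurable_floor.comp (measurable_const_add (u i)))
  have hgi : ∀ i, MeasureTheory.IntegrableOn (g i) (Set.Ico (0 : ℝ) 1) := fun i =>
    MeasureTheory.Integrable.of_bound (hgm i).aestronglyMeasurable K
      (MeasureTheory.ae_of_all _ fun s => hK _)
  have hK0 : 0 ≤ K := (abs_nonneg _).trans (hK 0)
  have hgi2 : ∀ i j, MeasureTheory.IntegrableOn (fun s => (g i s - g j s) ^ 2)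
      (Set.Ico (0 : ℝ) 1) := fun i j => by
    refine MeasureTheory.Integrable.of_bound
      (((hgm i).sub (hgm j)).pow_const 2).aestronglyMeasurable ((2 * K) ^ 2)
      (MeasureTheory.ae_of_all _ fun s => ?_)
    rw [Real.norm_eq_abs, abs_pow]
    refine pow_le_pow_left₀ (abs_nonneg _) ((abs_sub _ _).trans ?_) 2
    have h1 : |g i s| ≤ K := hK _
    have h2 : |g j s| ≤ K := hK _
    linarith
  calc jamesSum (fun i => interp x (u i)) n p
      = ∑ j ∈ Finset.range n, (∫ s in Set.Ico (0 : ℝ) 1, (g (p (j + 1)) s - g (p j) s)) ^ 2 := by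
        refine Finset.sum_congr rfl fun j _ => ?_
        simp only [sq_abs]
        rw [interp_eq_integral x (hu0 _), interp_eq_integral x (hu0 _),
          MeasureTheory.integral_sub (hgi _) (hgi _)]
    _ ≤ ∑ j ∈ Finset.range n, ∫ s in Set.Ico (0 : ℝ) 1, (g (p (j + 1)) s - g (p j) s) ^ 2 :=
        Finset.sum_le_sum fun j _ => sq_setIntegral_le ((hgi _).sub (hgi _)) (hgi2 _ _)
    _ = ∫ s in Set.Ico (0 : ℝ) 1, ∑ j ∈ Finset.range n, (g (p (j + 1)) s - g (p j) s) ^ 2 :=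
        (MeasureTheory.integral_finsetSum _ fun j _ => hgi2 _ _).symm
    _ ≤ ∫ _ in Set.Ico (0 : ℝ) 1, B := by
        refine MeasureTheory.integral_mono (MeasureTheory.integrable_finsetSum _ fun j _ =>
          hgi2 _ _) (MeasureTheory.integrableOn_const (by simp)) fun s => ?_
        have := jamesSum_le_of_monotone h n (q := fun j => ⌊u (p j) + s⌋₊) fun a b hab =>
          Nat.floor_mono (by linarith [hu (hp.monotone hab)])
        simpa [jamesSum, g] using this
    _ = B := by simp

theorem tendsto_interp {x : ℕ → ℝ} {c : ℝ} (hx : Tendsto x atTop (𝓝 c)) {u : ℕ → ℝ}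
    (hu0 : ∀ i, 0 ≤ u i) (hu : Tendsto u atTop atTop) :
    Tendsto (fun i => interp x (u i)) atTop (𝓝 c) := by
  have hfl : Tendsto (fun i => ⌊u i⌋₊) atTop atTop := tendsto_nat_floor_atTop.comp hu
  have h1 := ((hx.comp hfl).sub_const c).abs
  have h2 := ((hx.comp ((tendsto_add_atTop_nat 1).comp hfl)).sub_const c).abs
  have h3 := h1.add h2
  simp only [sub_self, abs_zero, add_zero] at h3
  refine tendsto_iff_norm_sub_tendsto_zero.2
    (squeeze_zero (fun _ => norm_nonneg _) (fun i => ?_) h3)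
  have f1 := Nat.floor_le (hu0 i)
  have f2 := Nat.lt_floor_add_one (u i)
  have e : interp x (u i) - c = (1 - (u i - ⌊u i⌋₊)) * (x ⌊u i⌋₊ - c) +
      (u i - ⌊u i⌋₊) * (x (⌊u i⌋₊ + 1) - c) := by
    rw [interp]
    ring
  rw [Real.norm_eq_abs, e]
  refine (abs_add_le _ _).trans (add_le_add ?_ ?_) <;> rw [abs_mul] <;>
    refine mul_le_of_le_one_left (abs_nonneg _) ?_ <;> rw [abs_le] <;> constructor <;> linarith

namespace JamesSpace

/-- Sampling the piecewise linear interpolation of the elements of `J` along `u`. -/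
noncomputable def resample (u : ℕ → ℝ) (hu : Monotone u) (hu0 : ∀ i, 0 ≤ u i)
    (hlim : Tendsto u atTop atTop) : JamesSpace →L[ℝ] JamesSpace :=
  LinearMap.mkContinuous
    { toFun := fun x => mk (fun i => interp x.coord (u i))
        ⟨tendsto_interp x.isJamesSeq_coord.1 hu0 hlim, ‖x‖ ^ 2, by
          rintro _ ⟨n, p, hp, rfl⟩
          exact jamesSum_interp_le x.abs_coord_le (fun n p hp => x.jamesSum_coord_le n hp)
            hu hu0 n p hp⟩
      map_add' := fun x y => coord_injective (funext fun i => by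
        simp only [coord_mk, coord_add, Pi.add_apply, interp]
        ring)
      map_smul' := fun c x => coord_injective (funext fun i => by
        simp only [coord_mk, coord_smul, Pi.smul_apply, interp, smul_eq_mul, RingHom.id_apply]
        ring) } 1 fun x => by
    rw [one_mul]
    refine (sq_le_sq₀ (norm_nonneg _) (norm_nonneg x)).1 (norm_sq_le fun n p hp => ?_)
    exact jamesSum_interp_le x.abs_coord_le (fun n p hp => x.jamesSum_coord_le n hp)
            hu hu0 n p hp

section
variable {u : ℕ → ℝ} (hu : Monotone u) (hu0 : ∀ i, 0 ≤ u i) (hlim : Tendsto u atTop atTop)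

theorem coord_resample (x : JamesSpace) (i : ℕ) :
    (resample u hu hu0 hlim x).coord i = interp x.coord (u i) := rfl

theorem norm_resample_le : ‖resample u hu hu0 hlim‖ ≤ 1 :=
  LinearMap.mkContinuous_norm_le _ zero_le_one _

end

/-- The tail operator as a continuous linear map. -/
noncomputable def tailCLM (M : ℕ) : JamesSpace →L[ℝ] JamesSpace :=
  LinearMap.mkContinuous
    { toFun := tail M
      map_add' := fun x y => coord_injective (funext fun i => by
        simp only [coord_tail, coord_add, Pi.add_apply]
        split_ifs <;> simp)
      map_smul' := fun c x => coord_injective (funext fun i => by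
        simp only [coord_tail, coord_smul, Pi.smul_apply, RingHom.id_apply]
        split_ifs <;> simp) } 2 fun x => norm_tail_le M x

@[simp] theorem tailCLM_apply (M : ℕ) (x : JamesSpace) : tailCLM M x = tail M x := rfl

theorem norm_tailCLM_le (M : ℕ) : ‖tailCLM M‖ ≤ 2 :=
  LinearMap.mkContinuous_norm_le _ zero_le_two _

end JamesSpace

/-! ### Convex combinations of functionals on a weakly compact convex set -/

/-- If a sequence of functionals tends to `0` at each point of a compact convex set, some convex
combinations of its late terms are uniformly small on this set. -/
theorem exists_convex_combination_le {W : Type*} [AddCommGroup W] [Module ℝ W]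
    [TopologicalSpace W] {K : Set W} (hK : IsCompact K) (hconv : Convex ℝ K)
    (T : ℕ → W →ₗ[ℝ] ℝ) (hT : ∀ j, Continuous (T j))
    (h0 : ∀ x ∈ K, Tendsto (fun j => T j x) atTop (𝓝 0)) {ε : ℝ} (hε : 0 < ε) (N : ℕ) :
    ∃ (n : ℕ) (c : ℕ → ℝ), (∀ i, i < n → 0 ≤ c i) ∧ ∑ i ∈ Finset.range n, c i = 1 ∧
      ∀ x ∈ K, ∑ i ∈ Finset.range n, c i * T (N + i) x ≤ ε := by
  rcases K.eq_empty_or_nonempty with rfl | ⟨x₀, hx₀⟩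
  · exact ⟨1, fun _ => 1, by simp, by simp, by simp⟩
  -- By compactness finitely many indices suffice for every point of `K` to have some value below
  -- `ε`. The image of `K` in `ℝⁿ` then misses the orthant `O`, and the normalised separating
  -- functional gives the weights.
  obtain ⟨s, hs⟩ := hK.elim_finite_subfamily_closed (fun j => {x | ε ≤ T (N + j) x})
    (fun j => isClosed_le continuous_const (hT _)) (by
      refine Set.eq_empty_iff_forall_notMem.2 fun x hx => ?_
      have h1 : ∀ j, ε ≤ T (N + j) x := fun j => Set.mem_iInter.1 hx.2 j
      have h2 : Tendsto (fun j => T (N + j) x) atTop (𝓝 0) := by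
        exact (h0 x hx.1).comp (tendsto_atTop_mono (fun j => Nat.le_add_left j N) tendsto_id)
      exact hε.not_ge (ge_of_tendsto' h2 h1))
  obtain ⟨n, hn⟩ := s.exists_nat_subset_range
  let Φ : W →ₗ[ℝ] (Fin n → ℝ) := LinearMap.pi fun i => T (N + i)
  have hΦ : Continuous Φ := continuous_pi fun i => hT _
  let O : Set (Fin n → ℝ) := {y | ∀ i, ε ≤ y i}
  have hO : O = Set.Ici fun _ => ε := rfl
  have hdisj : Disjoint (Φ '' K) O := by
    refine Set.disjoint_left.2 ?_
    rintro _ ⟨x, hx, rfl⟩ hxO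
    have : x ∈ K ∩ ⋂ j ∈ s, {x | ε ≤ T (N + j) x} :=
      ⟨hx, Set.mem_iInter₂.2 fun j hj => hxO ⟨j, Finset.mem_range.1 (hn hj)⟩⟩
    rw [hs] at this
    exact this
  obtain ⟨f, a, b, hfa, hab, hfb⟩ := geometric_hahn_banach_compact_closed
    (hconv.linear_image Φ) (hK.image hΦ) (hO ▸ convex_Ici _) (hO ▸ isClosed_Ici) hdisj
  let w : ℕ → ℝ := fun i => f fun k => if (k : ℕ) = i then 1 else 0
  have hf : ∀ y : Fin n → ℝ, f y = ∑ k, y k * w k := by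
    intro y
    refine (LinearMap.pi_apply_eq_sum_univ f.toLinearMap y).trans ?_
    refine Finset.sum_congr rfl fun i _ => ?_
    simp only [w, smul_eq_mul, Fin.val_inj, eq_comm (a := i)]
    rfl
  have hwpos : ∀ i, i < n → 0 ≤ w i := by
    intro i hi
    by_contra! hneg
    have h1 : b < f fun _ => ε := hfb _ fun _ => le_rfl
    -- With a negative weight, moving this far in direction `i` stays in `O` but brings `f` down to
    -- `b`.
    set r := ((f fun _ => ε) - b) / (-w i) with hr
    have hr0 : 0 ≤ r := div_nonneg (by linarith) (by linarith)
    have h2 := hfb ((fun _ => ε) + r • fun k : Fin n => if (k : ℕ) = i then (1 : ℝ) else 0)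
      fun k => by
        simp only [Pi.add_apply, Pi.smul_apply, smul_eq_mul]
        split_ifs <;> simp [hr0]
    rw [map_add, map_smul, smul_eq_mul] at h2
    have h3 : r * w i = -((f fun _ => ε) - b) := by
      rw [hr, div_neg, neg_mul, div_mul_cancel₀ _ hneg.ne]
    change b < _ + r * w i at h2
    linarith
  set S := ∑ k ∈ Finset.range n, w k with hS
  have hS0 : 0 ≤ S := Finset.sum_nonneg fun i hi => hwpos i (Finset.mem_range.1 hi)
  have hfS : (f fun _ => ε) = ε * S := by
    rw [hf, ← Finset.mul_sum, hS, Finset.sum_range]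
  have hb : b < ε * S := hfS ▸ hfb _ fun _ => le_rfl
  have hSpos : 0 < S := by
    refine hS0.lt_of_ne fun h => ?_
    have hw : ∀ i ∈ Finset.range n, w i = 0 :=
      (Finset.sum_eq_zero_iff_of_nonneg fun i hi => hwpos i (Finset.mem_range.1 hi)).1
        (hS ▸ h.symm)
    have e : f (Φ x₀) = 0 := by
      rw [hf]
      exact Finset.sum_eq_zero fun k _ => by rw [hw k (Finset.mem_range.2 k.2), mul_zero]
    have h1 := hfa _ ⟨x₀, hx₀, rfl⟩
    rw [← h, mul_zero] at hb
    linarith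
  refine ⟨n, fun i => w i / S, fun i hi => div_nonneg (hwpos i hi) hS0, ?_, fun x hx => ?_⟩
  · rw [← Finset.sum_div, ← hS, div_self hSpos.ne']
  · have h1 := hfa _ ⟨x, hx, rfl⟩
    have e : ∑ i ∈ Finset.range n, w i / S * T (N + i) x = f (Φ x) / S := by
      rw [hf, Finset.sum_range, Finset.sum_div]
      refine Finset.sum_congr rfl fun i _ => ?_
      simp only [Φ, LinearMap.pi_apply]
      ring
    rw [e, div_le_iff₀ hSpos]
    linarith

theorem exists_mem_block {N : ℕ → ℕ} (hN : StrictMono N) (hN0 : N 0 = 0) (i : ℕ) :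
    ∃ k, N k ≤ i ∧ i < N (k + 1) := by
  induction i with
  | zero => exact ⟨0, hN0.le, hN0.symm.trans_lt (hN zero_lt_one)⟩
  | succ i ih =>
    obtain ⟨k, h1, h2⟩ := ih
    rcases (Nat.succ_le_of_lt h2).lt_or_eq with h | h
    · exact ⟨k, by omega, h⟩
    · exact ⟨k + 1, h.ge, h.le.trans_lt (hN (Nat.lt_succ_self _))⟩

/-- Weights on consecutive blocks which give small convex combinations on each block. -/
theorem exists_block_weights {W : Type*} [AddCommGroup W] [Module ℝ W]
    [TopologicalSpace W] {K : Set W} (hK : IsCompact K) (hconv : Convex ℝ K)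
    (T : ℕ → W →ₗ[ℝ] ℝ) (hT : ∀ j, Continuous (T j))
    (h0 : ∀ x ∈ K, Tendsto (fun j => T j x) atTop (𝓝 0)) {ε : ℕ → ℝ} (hε : ∀ k, 0 < ε k) :
    ∃ (d : ℕ → ℝ) (N : ℕ → ℕ), StrictMono N ∧ N 0 = 0 ∧ (∀ j, 0 ≤ d j) ∧
      (∀ k, ∑ j ∈ Finset.Ico (N k) (N (k + 1)), d j = 1) ∧
      ∀ k, ∀ x ∈ K, ∑ j ∈ Finset.Ico (N k) (N (k + 1)), d j * T j x ≤ ε k := by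
  choose n c hc0 hc1 hcK using fun k N =>
    exists_convex_combination_le hK hconv T hT h0 (hε k) N
  have hn : ∀ k N, 0 < n k N := fun k N => Nat.pos_of_ne_zero fun h => by
    have := hc1 k N
    simp [h] at this
  -- Block `k` starts at `N k` and has the length of the convex combination found there for
  -- tolerance `ε k`.
  let N : ℕ → ℕ := fun k => Nat.rec 0 (fun k M => M + n k M) k
  have hNs : ∀ k, N (k + 1) = N k + n k (N k) := fun _ => rfl
  have hN : StrictMono N := strictMono_nat_of_lt_succ fun k => by
    rw [hNs]
    exact Nat.lt_add_of_pos_right (hn _ _)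
  choose κ hκ1 hκ2 using exists_mem_block hN rfl
  have hκ : ∀ k i, i < n k (N k) → κ (N k + i) = k := by
    intro k i hi
    have h1 := hκ1 (N k + i)
    have h2 := hκ2 (N k + i)
    have h3 : N k + i < N (k + 1) := by rw [hNs]; omega
    have h4 : κ (N k + i) < k + 1 := hN.lt_iff_lt.1 (lt_of_le_of_lt h1 h3)
    have h5 : k < κ (N k + i) + 1 := hN.lt_iff_lt.1 (lt_of_le_of_lt (Nat.le_add_right (N k) i) h2)
    omega
  let d : ℕ → ℝ := fun j => c (κ j) (N (κ j)) (j - N (κ j))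
  have hd : ∀ k i, i < n k (N k) → d (N k + i) = c k (N k) i := fun k i hi => by
    simp only [d, hκ k i hi, Nat.add_sub_cancel_left]
  have hsum : ∀ k (f : ℕ → ℝ), ∑ j ∈ Finset.Ico (N k) (N (k + 1)), d j * f j =
      ∑ i ∈ Finset.range (n k (N k)), c k (N k) i * f (N k + i) := by
    intro k f
    rw [Finset.sum_Ico_eq_sum_range, hNs, Nat.add_sub_cancel_left]
    exact Finset.sum_congr rfl fun i hi => by rw [hd k i (Finset.mem_range.1 hi)]
  refine ⟨d, N, hN, rfl, fun j => hc0 _ _ _ ?_, fun k => ?_, fun k x hx => ?_⟩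
  · have h1 := hκ1 j
    have h2 := hκ2 j
    rw [hNs] at h2
    omega
  · simpa [hc1] using hsum k fun _ => 1
  · rw [hsum k fun j => T j x]
    exact hcK k (N k) x hx

/-! ### Weak compactness -/

/-- The adjoint of a bounded operator on a normed space. -/
noncomputable def adjointCLM {E : Type*} [NormedAddCommGroup E] [NormedSpace ℝ E]
    (A : E →L[ℝ] E) : StrongDual ℝ E →L[ℝ] StrongDual ℝ E :=
  ContinuousLinearMap.precomp ℝ A

/-- The adjoint of `A` is weakly compact if the second adjoint takes its values in the space. -/
theorem isWeaklyCompactOperator_adjointCLM {E : Type*} [NormedAddCommGroup E] [NormedSpace ℝ E]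
    (A : E →L[ℝ] E)
    (h : ∀ Ψ : StrongDual ℝ (StrongDual ℝ E), ∃ z : E, ∀ φ : StrongDual ℝ E, Ψ (φ.comp A) = φ z) :
    IsWeaklyCompactOperator (adjointCLM A) := by
  -- The hypothesis makes the adjoint weak*-to-weak continuous, so Banach–Alaoglu gives a weakly
  -- compact image.
  let g : WeakDual ℝ E → WeakSpace ℝ (StrongDual ℝ E) := fun φ =>
    toWeakSpace ℝ _ ((WeakDual.toStrongDual φ).comp A)
  have hg : Continuous g := by
    refine WeakBilin.continuous_of_continuous_eval _ fun Ψ => ?_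
    obtain ⟨z, hz⟩ := h Ψ
    exact (WeakDual.eval_continuous z).congr fun φ => (hz (WeakDual.toStrongDual φ)).symm
  exact .of_subset ((WeakDual.isCompact_closedBall 0 1).image hg) fun φ hφ =>
    ⟨StrongDual.toWeakDual φ, hφ, rfl⟩

/-- The Minkowski sum of the weak closures of the images of the ball works: each summand contains
`0`, so the sum contains them all. -/
theorem IsWeaklyCompactOperator.exists_convex_compact {E : Type*} [NormedAddCommGroup E]
    [NormedSpace ℝ E] (F : Finset (E →L[ℝ] E)) (hF : ∀ U ∈ F, IsWeaklyCompactOperator U) :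
    ∃ K : Set (WeakSpace ℝ E), IsCompact K ∧ Convex ℝ K ∧ 0 ∈ K ∧
      ∀ U ∈ F, ∀ x ∈ Metric.closedBall (0 : E) 1, toWeakSpace ℝ E (U x) ∈ K := by
  classical
  induction F using Finset.induction_on with
  | empty => exact ⟨{0}, isCompact_singleton, convex_singleton 0, rfl, by simp⟩
  | insert U F _ ih =>
    obtain ⟨K, hK, hconv, h0, hmem⟩ := ih fun V hV => hF V (Finset.mem_insert_of_mem hV)
    have hU := hF U (Finset.mem_insert_self U F)
    set L := closure (toWeakSpace ℝ E '' (U '' Metric.closedBall 0 1)) with hL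
    have hL0 : (0 : WeakSpace ℝ E) ∈ L := by
      have := IsWeaklyCompactOperator.mem (T := U) (Metric.mem_closedBall_self zero_le_one)
      simpa using this
    have hLconv : Convex ℝ L :=
      (((convex_closedBall (0 : E) 1).linear_image U.toLinearMap).linear_image
        (toWeakSpace ℝ E).toLinearMap).closure
    let m : WeakSpace ℝ E × WeakSpace ℝ E →ₗ[ℝ] WeakSpace ℝ E :=
      LinearMap.fst ℝ _ _ + LinearMap.snd ℝ _ _
    refine ⟨m '' (L ×ˢ K), (IsCompact.prod hU hK).image continuous_add,
      (hLconv.prod hconv).linear_image m, ⟨(0, 0), ⟨hL0, h0⟩, by simp [m]⟩, ?_⟩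
    intro V hV x hx
    rcases Finset.mem_insert.1 hV with rfl | hV
    · exact ⟨(_, 0), ⟨IsWeaklyCompactOperator.mem hx, h0⟩, by simp [m]⟩
    · exact ⟨(0, _), ⟨hL0, hmem V hV x hx⟩, by simp [m]⟩

theorem exists_block_weights_weakSpace {E : Type*} [NormedAddCommGroup E] [NormedSpace ℝ E]
    {K : Set (WeakSpace ℝ E)} (hK : IsCompact K) (hconv : Convex ℝ K) (Ψ : ℕ → StrongDual ℝ E)
    (h0 : ∀ x, Tendsto (fun j => Ψ j x) atTop (𝓝 0)) {ε : ℕ → ℝ} (hε : ∀ k, 0 < ε k) :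
    ∃ (d : ℕ → ℝ) (N : ℕ → ℕ), StrictMono N ∧ N 0 = 0 ∧ (∀ j, 0 ≤ d j) ∧
      (∀ k, ∑ j ∈ Finset.Ico (N k) (N (k + 1)), d j = 1) ∧
      ∀ k x, toWeakSpace ℝ E x ∈ K →
        ∑ j ∈ Finset.Ico (N k) (N (k + 1)), d j * Ψ j x ≤ ε k := by
  let T : ℕ → WeakSpace ℝ E →ₗ[ℝ] ℝ := fun j =>
    (Ψ j).toLinearMap ∘ₗ (toWeakSpace ℝ E).symm.toLinearMap
  have hT : ∀ j, Continuous (T j) := fun j =>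
    WeakBilin.eval_continuous (topDualPairing ℝ E).flip (Ψ j)
  obtain ⟨d, N, hN, hN0, hd, h1, hdK⟩ := exists_block_weights hK hconv T hT
    (fun x _ => h0 ((toWeakSpace ℝ E).symm x)) hε
  exact ⟨d, N, hN, hN0, hd, h1, fun k x hx => hdK k _ hx⟩

/-- The net is indexed by pairs of a finite set and a natural number `n`, with tolerance `1 / (n +
1)`. -/
theorem hasBoundedLeftApproxIdentity_of_finset {A : Type*} [NonUnitalNormedRing A] (C : ℝ)
    (h : ∀ (F : Finset A) (δ : ℝ), 0 < δ → ∃ V : A, ‖V‖ ≤ C ∧ ∀ U ∈ F, ‖U - V * U‖ ≤ δ) :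
    HasBoundedLeftApproxIdentity A := by
  classical
  choose V hVC hV using fun α : Finset A × ℕ => h α.1 (1 / ((α.2 : ℝ) + 1)) (by positivity)
  refine ⟨_, inferInstance, inferInstance, inferInstance, V, ⟨C, hVC⟩, fun U => ?_⟩
  refine Metric.tendsto_atTop.2 fun ε hε => ?_
  obtain ⟨n, hn⟩ := exists_nat_one_div_lt hε
  refine ⟨({U}, n), fun α hα => ?_⟩
  rw [Real.dist_eq, sub_zero, abs_of_nonneg (norm_nonneg _)]
  refine (hV α U (hα.1 (Finset.mem_singleton_self U))).trans_lt (lt_of_le_of_lt ?_ hn)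
  have : (n : ℝ) ≤ α.2 := by exact_mod_cast hα.2
  gcongr

/-- The weakly compact approximation property of `E` gives a bounded left approximate identity of
the algebra of weakly compact operators. -/
theorem hasBoundedLeftApproxIdentity_of_weaklyCompact_approx {E : Type*} [NormedAddCommGroup E]
    [NormedSpace ℝ E] (C : ℝ)
    (h : ∀ K : Set (WeakSpace ℝ E), IsCompact K → Convex ℝ K → ∀ δ : ℝ, 0 < δ →
      ∃ V : E →L[ℝ] E, IsWeaklyCompactOperator V ∧ ‖V‖ ≤ C ∧
        ∀ x, toWeakSpace ℝ E x ∈ K → toWeakSpace ℝ E (-x) ∈ K → ‖x - V x‖ ≤ δ) :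
    HasBoundedLeftApproxIdentity (weaklyCompactOperators E) := by
  classical
  refine hasBoundedLeftApproxIdentity_of_finset C fun F δ hδ => ?_
  obtain ⟨K, hK, hconv, hmem⟩ := IsWeaklyCompactOperator.exists_convex_compact
    (F.image Subtype.val) fun U hU => by
      obtain ⟨U', -, rfl⟩ := Finset.mem_image.1 hU
      exact U'.2
  obtain ⟨V, hV, hVC, hVK⟩ := h K hK hconv δ hδ
  refine ⟨⟨V, hV⟩, hVC, fun U hU => ?_⟩
  have hU' := hmem.2 U.1 (Finset.mem_image_of_mem _ hU)
  have key : ‖U.1 - V.comp U.1‖ ≤ δ :=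
    ContinuousLinearMap.opNorm_le_of_unit_norm hδ.le fun x hx => by
      refine hVK _ (hU' x (by simp [hx])) ?_
      rw [← map_neg]
      exact hU' (-x) (by simp [hx])
  exact key

/-! ### The approximating operators on `J` and their adjoints. -/

namespace JamesSpace

section
variable {u : ℕ → ℝ} (hu : Monotone u) (hu0 : ∀ i, 0 ≤ u i) (hlim : Tendsto u atTop atTop)

/-- The operator `x ↦ x - R (x - x₀ e₀)`, where `R` samples the piecewise linear interpolation
along `u`. -/
noncomputable def resampleDefect : JamesSpace →L[ℝ] JamesSpace :=
  ContinuousLinearMap.id ℝ JamesSpace - (resample u hu hu0 hlim).comp (tailCLM 1)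

theorem norm_resampleDefect_le : ‖resampleDefect hu hu0 hlim‖ ≤ 3 := by
  have h1 : ‖(resample u hu hu0 hlim).comp (tailCLM 1)‖ ≤ 1 * 2 :=
    (ContinuousLinearMap.opNorm_comp_le _ _).trans
      (mul_le_mul (norm_resample_le hu hu0 hlim) (norm_tailCLM_le 1) (norm_nonneg _) zero_le_one)
  have h2 := norm_sub_le (ContinuousLinearMap.id ℝ JamesSpace)
    ((resample u hu hu0 hlim).comp (tailCLM 1))
  have h3 : ‖ContinuousLinearMap.id ℝ JamesSpace‖ ≤ 1 := ContinuousLinearMap.norm_id_le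
  rw [resampleDefect]
  linarith

theorem isWeaklyCompactOperator_adjointCLM_resampleDefect :
    IsWeaklyCompactOperator (adjointCLM (resampleDefect hu hu0 hlim)) := by
  refine isWeaklyCompactOperator_adjointCLM _ fun Ψ => ?_
  set A := resampleDefect hu hu0 hlim with hA
  let Ψ' : StrongDual ℝ (StrongDual ℝ JamesSpace) :=
    Ψ.comp (adjointCLM A)
  -- The coordinates of `Ψ` converge to some `c`, and deleting the first one and resampling keeps
  -- this limit. The difference is thus a null sequence and defines the required element of `J`.
  obtain ⟨c, hc⟩ := cauchySeq_tendsto_of_complete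
    (cauchySeq_of_bddAbove_jamesSums (bddAbove_jamesSums_bidual Ψ))
  have hc' : Tendsto (fun k => Ψ ((coordCLM k).comp (tailCLM 1))) atTop (𝓝 c) := by
    refine hc.congr' ?_
    filter_upwards [eventually_ge_atTop 1] with k hk
    congr 1
    ext x
    simp [coord_tail, hk.not_gt]
  have hz : Tendsto (fun i => Ψ' (coordCLM i)) atTop (𝓝 0) := by
    have h := hc.sub (tendsto_interp hc' hu0 hlim)
    rw [sub_self] at h
    refine h.congr fun i => ?_
    rw [interp, ← smul_eq_mul, ← smul_eq_mul, ← map_smul, ← map_smul, ← map_add, ← map_sub]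
    change _ = Ψ ((coordCLM i).comp A)
    congr 1
  refine ⟨mk _ ⟨hz, bddAbove_jamesSums_bidual Ψ'⟩, fun φ => ?_⟩
  have e : Ψ' = NormedSpace.inclusionInDoubleDual ℝ JamesSpace
      (mk _ ⟨hz, bddAbove_jamesSums_bidual Ψ'⟩) := bidual_ext fun i => rfl
  exact DFunLike.congr_fun e φ

end

/-! ### Sampling points given by partial sums of block weights. -/

section
variable {d : ℕ → ℝ} {N : ℕ → ℕ}

theorem sum_range_block (hN : StrictMono N) (hN0 : N 0 = 0)
    (h1 : ∀ k, ∑ j ∈ Finset.Ico (N k) (N (k + 1)), d j = 1) (k : ℕ) :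
    ∑ j ∈ Finset.range (N k), d j = k := by
  induction k with
  | zero => simp [hN0]
  | succ k ih =>
    rw [← Finset.sum_range_add_sum_Ico d (hN (Nat.lt_succ_self k)).le, ih, h1]
    push_cast
    rfl

theorem le_partialSum_le (hN : StrictMono N) (hN0 : N 0 = 0) (hd : ∀ j, 0 ≤ d j)
    (h1 : ∀ k, ∑ j ∈ Finset.Ico (N k) (N (k + 1)), d j = 1) {i k : ℕ} (hk : N k ≤ i)
    (hk' : i < N (k + 1)) : (k : ℝ) ≤ ∑ j ∈ Finset.range (i + 1), d j ∧
      ∑ j ∈ Finset.range (i + 1), d j ≤ k + 1 := by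
  have mono : ∀ a b : ℕ, a ≤ b → ∑ j ∈ Finset.range a, d j ≤ ∑ j ∈ Finset.range b, d j :=
    fun a b h => Finset.sum_le_sum_of_subset_of_nonneg (Finset.range_mono h) fun j _ _ => hd j
  constructor
  · rw [← sum_range_block hN hN0 h1 k]
    exact mono _ _ (by omega)
  · have := sum_range_block hN hN0 h1 (k + 1)
    push_cast at this
    rw [← this]
    exact mono _ _ hk'

theorem tendsto_partialSum (hN : StrictMono N) (hN0 : N 0 = 0) (hd : ∀ j, 0 ≤ d j)
    (h1 : ∀ k, ∑ j ∈ Finset.Ico (N k) (N (k + 1)), d j = 1) :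
    Tendsto (fun i => ∑ j ∈ Finset.range (i + 1), d j) atTop atTop := by
  refine tendsto_atTop_atTop_of_monotone (fun a b h =>
    Finset.sum_le_sum_of_subset_of_nonneg (Finset.range_mono (by omega)) fun j _ _ => hd j)
    fun b => ?_
  obtain ⟨k, hk⟩ := exists_nat_ge b
  exact ⟨N k, hk.trans
    (le_partialSum_le hN hN0 hd h1 le_rfl (hN (Nat.lt_succ_self k))).1⟩

/-- The interpolant of `initial (m + 1)` is `1` up to `m` and falls linearly to `0` at `m + 1`. For
`i` in block `m`, its value at the partial sum is the weight remaining in the block after `i`.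
Before and after the block both sides are `1` and `0`. -/
theorem interp_initial_partialSum (hN : StrictMono N) (hN0 : N 0 = 0) (hd : ∀ j, 0 ≤ d j)
    (h1 : ∀ k, ∑ j ∈ Finset.Ico (N k) (N (k + 1)), d j = 1) (m i : ℕ) :
    interp (initial (m + 1)).coord (∑ j ∈ Finset.range (i + 1), d j) =
      ∑ j ∈ Finset.Ico (N m) (N (m + 1)), d j * (initial j).coord i := by
  obtain ⟨k, hk, hk'⟩ := exists_mem_block hN hN0 i
  obtain ⟨hu1, hu2⟩ := le_partialSum_le hN hN0 hd h1 hk hk'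
  rw [interp_eq hu1 hu2]
  simp only [coord_initial]
  rcases lt_trichotomy k m with h | rfl | h
  · rw [if_pos (by omega), if_pos (by omega)]
    have e : ∀ j ∈ Finset.Ico (N m) (N (m + 1)), d j * (if i < j then 1 else 0) = d j := by
      intro j hj
      have h2 := hN.monotone (Nat.succ_le_of_lt h)
      have h3 := (Finset.mem_Ico.1 hj).1
      rw [if_pos (hk'.trans_le (h2.trans h3)), mul_one]
    rw [Finset.sum_congr rfl e, h1]
    ring
  · rw [if_pos (by omega), if_neg (by omega)]
    rw [← Finset.sum_Ico_consecutive _ (show N k ≤ i + 1 by omega) hk']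
    have e1 : ∀ j ∈ Finset.Ico (N k) (i + 1), d j * (if i < j then 1 else 0) = 0 := fun j hj => by
      rw [if_neg (by have := (Finset.mem_Ico.1 hj).2; omega), mul_zero]
    have e2 : ∀ j ∈ Finset.Ico (i + 1) (N (k + 1)), d j * (if i < j then 1 else 0) = d j :=
      fun j hj => by rw [if_pos (by have := (Finset.mem_Ico.1 hj).1; omega), mul_one]
    rw [Finset.sum_congr rfl e1, Finset.sum_congr rfl e2, Finset.sum_const_zero]
    have e3 := Finset.sum_range_add_sum_Ico d (Nat.succ_le_of_lt hk')
    have e4 := sum_range_block hN hN0 h1 (k + 1)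
    push_cast at e4
    simp only [Nat.succ_eq_add_one] at e3
    linarith
  · rw [if_neg (by omega), if_neg (by omega)]
    have e : ∀ j ∈ Finset.Ico (N m) (N (m + 1)), d j * (if i < j then 1 else 0) = 0 := by
      intro j hj
      have h2 := hN.monotone (Nat.succ_le_of_lt h)
      have h3 := (Finset.mem_Ico.1 hj).2
      rw [if_neg (by simp only [Nat.succ_eq_add_one] at h2; omega), mul_zero]
    rw [Finset.sum_congr rfl e, Finset.sum_const_zero]
    ring

theorem resample_initial_succ (hN : StrictMono N) (hN0 : N 0 = 0) (hd : ∀ j, 0 ≤ d j)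
    (h1 : ∀ k, ∑ j ∈ Finset.Ico (N k) (N (k + 1)), d j = 1) (hu hu0 hlim) (m : ℕ) :
    resample (fun i => ∑ j ∈ Finset.range (i + 1), d j) hu hu0 hlim (initial (m + 1)) =
      ∑ j ∈ Finset.Ico (N m) (N (m + 1)), d j • initial j := by
  refine coord_injective (funext fun i => ?_)
  rw [coord_resample, interp_initial_partialSum hN hN0 hd h1, coord_sum]
  rfl

end

/-- A functional with small values on the differences of consecutive vectors `R (initial m)` is
small on the whole range of `R` on the vectors with first coordinate `0`. -/
theorem abs_apply_comp_tail_le (φ : StrongDual ℝ JamesSpace) (R : JamesSpace →L[ℝ] JamesSpace)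
    {ε : ℕ → ℝ} {δ : ℝ} (hδ : ∀ n, ∑ m ∈ Finset.range n, ε m ≤ δ)
    (h : ∀ m, |φ (R (initial (m + 2))) - φ (R (initial (m + 1)))| ≤ ε m) (x : JamesSpace) :
    |φ (R (tail 1 x))| ≤ δ * ‖x‖ := by
  set z := tail 1 x with hz
  have hz0 : z.coord 0 = 0 := by simp [hz, coord_tail]
  have hzx : ∀ i, |z.coord (i + 1)| ≤ ‖x‖ := fun i => by
    simpa [hz, coord_tail] using x.abs_coord_le (i + 1)
  have hlim : Tendsto (fun n => |φ (R (z - tail (n + 1) z))|) atTop (𝓝 |φ (R z)|) :=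
    (((φ.comp R).continuous.tendsto z).comp
      (z.tendsto_sub_tail.comp (tendsto_add_atTop_nat 1))).abs
  refine le_of_tendsto' hlim fun n => ?_
  -- The vanishing first coordinate removes the term of `initial 1 - initial 0`, which `h` does not
  -- control.
  rw [sub_tail, Finset.sum_range_succ', hz0, zero_smul, add_zero, map_sum, map_sum]
  calc |∑ i ∈ Finset.range n, φ (R (z.coord (i + 1) • (initial (i + 1 + 1) - initial (i + 1))))|
      ≤ ∑ i ∈ Finset.range n, ε i * ‖x‖ := by
        refine (Finset.abs_sum_le_sum_abs _ _).trans (Finset.sum_le_sum fun i _ => ?_)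
        rw [map_smul, map_smul, smul_eq_mul, abs_mul, map_sub, map_sub, mul_comm]
        exact mul_le_mul (h i) (hzx i) (abs_nonneg _) ((abs_nonneg _).trans (h i))
    _ = (∑ i ∈ Finset.range n, ε i) * ‖x‖ := (Finset.sum_mul _ _ _).symm
    _ ≤ δ * ‖x‖ := by gcongr; exact hδ n

/-- The dual of James' space has the weakly compact approximation property. -/
theorem exists_weaklyCompact_approx {K : Set (WeakSpace ℝ (StrongDual ℝ JamesSpace))}
    (hK : IsCompact K) (hconv : Convex ℝ K) {δ : ℝ} (hδ : 0 < δ) :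
    ∃ V : StrongDual ℝ JamesSpace →L[ℝ] StrongDual ℝ JamesSpace, IsWeaklyCompactOperator V ∧
      ‖V‖ ≤ 3 ∧ ∀ φ, toWeakSpace ℝ _ φ ∈ K → toWeakSpace ℝ _ (-φ) ∈ K → ‖φ - V φ‖ ≤ δ := by
  obtain ⟨σ, hσ⟩ := exists_bidual_one
  let T : ℕ → StrongDual ℝ (StrongDual ℝ JamesSpace) := fun j =>
    σ - NormedSpace.inclusionInDoubleDual ℝ JamesSpace (initial j)
  have hTapp : ∀ j φ, T j φ = σ φ - φ (initial j) := fun _ _ => rfl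
  have hT0 : ∀ φ, Tendsto (fun j => T j φ) atTop (𝓝 0) := fun φ => by
    have h := (hσ φ).const_sub (σ φ)
    rwa [sub_self] at h
  -- Chosen so that `ε (m + 1) + ε m` is at most `δ / 2 * (1 / 2) ^ m`, with total at most `δ`.
  set ε : ℕ → ℝ := fun k => δ / 4 * (1 / 2) ^ k with hε
  obtain ⟨d, N, hN, hN0, hd, h1, hdK⟩ := exists_block_weights_weakSpace hK hconv T hT0
    (ε := ε) fun k => by positivity
  have hu0 : ∀ i, 0 ≤ ∑ j ∈ Finset.range (i + 1), d j := fun i =>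
    Finset.sum_nonneg fun j _ => hd j
  have hu : Monotone fun i => ∑ j ∈ Finset.range (i + 1), d j := fun a b h =>
    Finset.sum_le_sum_of_subset_of_nonneg (Finset.range_mono (by omega)) fun j _ _ => hd j
  have hlim := tendsto_partialSum hN hN0 hd h1
  set A := resampleDefect hu hu0 hlim with hA
  refine ⟨adjointCLM A, isWeaklyCompactOperator_adjointCLM_resampleDefect _ _ _,
    ContinuousLinearMap.opNorm_le_bound _ (by norm_num) fun φ => ?_, fun φ hφ hφ' => ?_⟩
  · refine (ContinuousLinearMap.opNorm_comp_le φ A).trans ?_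
    rw [mul_comm]
    gcongr
    exact norm_resampleDefect_le hu hu0 hlim
  · set R := resample _ hu hu0 hlim with hR
    have hblock : ∀ m, |σ φ - φ (R (initial (m + 1)))| ≤ ε m := by
      intro m
      have e : ∀ χ : StrongDual ℝ JamesSpace, ∑ j ∈ Finset.Ico (N m) (N (m + 1)),
          d j * T j χ = σ χ - χ (R (initial (m + 1))) := by
        intro χ
        rw [hR, resample_initial_succ hN hN0 hd h1, map_sum]
        simp only [hTapp, mul_sub, Finset.sum_sub_distrib, map_smul, smul_eq_mul]
        rw [← Finset.sum_mul, h1, one_mul]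
      -- The convex combinations are bounded only from above on `K`; applying this to `φ` and `-φ`
      -- bounds the absolute value.
      have p1 := hdK m _ hφ
      have p2 := hdK m _ hφ'
      rw [e] at p1 p2
      rw [map_neg, neg_apply] at p2
      exact abs_le.2 ⟨by linarith, p1⟩
    have hdiff : φ - adjointCLM A φ = φ.comp (R.comp (tailCLM 1)) := by
      ext x
      change φ x - φ (x - R (tail 1 x)) = φ (R (tail 1 x))
      rw [map_sub]
      ring
    rw [hdiff]
    refine ContinuousLinearMap.opNorm_le_bound _ hδ.le fun x => ?_
    refine abs_apply_comp_tail_le φ R (ε := fun m => ε (m + 1) + ε m) (fun n => ?_)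
      (fun m => ?_) x
    · have e : ∀ m, ε (m + 1) + ε m ≤ δ / 2 * (1 / 2) ^ m := fun m => by
        have : (0 : ℝ) < δ * (1 / 2) ^ m := by positivity
        simp only [hε, pow_succ]
        linarith
      refine (Finset.sum_le_sum fun m _ => e m).trans ?_
      rw [← Finset.mul_sum]
      nlinarith [sum_geometric_two_le n]
    · have := abs_sub_le (φ (R (initial (m + 2)))) (σ φ) (φ (R (initial (m + 1))))
      have h2 := hblock (m + 1)
      rw [abs_sub_comm] at h2
      exact this.trans (add_le_add h2 (hblock m))

end JamesSpace

theorem corollary3p5 :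
    HasBoundedLeftApproxIdentity (weaklyCompactOperators (StrongDual ℝ JamesSpace)) :=
  hasBoundedLeftApproxIdentity_of_weaklyCompact_approx 3 fun _ hK hconv _ hδ =>
    JamesSpace.exists_weaklyCompact_approx hK hconv hδ
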